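/- Let $n\ge 2$, let $(M_*,g_*)$ be a nonempty smooth Riemannian manifold of dimension $n-1$ (without boundary), let $J\subseteq\mathbb{R}$ be a nonempty open set (for instance an open interval, or $J=\mathbb{R}$), and let $h,f\colon J\to\mathbb{R}$ be smooth functions with $h'(t)\neq 0$ for all $t\in J$. Equip the $n$-dimensional manifold $M=J\times M_*$ with the warped product metric $$g=dt^2+h'(t)^2\,g_*$$ and regard $f=f(t)$ as a function on $M$. Write $\mathrm{Ric}$, $S$, $\nabla^2 f$, $\Delta f=\operatorname{tr}_g\nabla^2 f$ for the Ricci tensor and the scalar curvature of $g$, the Hessian and the Laplacian of $f$, and $\mathrm{Ric}_*$, $S_*$ for the Ricci tensor and the scalar curvature of $g_*$. The metric $g$ with potential $f$ is called a steady Ricci–Bourguignon gradient soliton if $$\mathrm{Ric}+\nabla^2 f-\frac{S}{n}\,g=0 .$$ Then the Laplacian of $f$ is $$\Delta f=f''+(n-1)\frac{f'h''}{h'},$$ and $g$ with potential $f$ is a steady Ricci–Bourguignon gradient soliton if and only if there is a constant $\lambda_*\in\mathbb{R}$ such that $g_*$ is an Einstein metric with $\mathrm{Ric}_*=\lambda_*\,g_*$,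 so that $\lambda_*=S_*/(n-1)$ is the normalized scalar curvature of $g_*$, and the following two equations hold on $J$: $$(n-2)\bigl[h''^2-h'h'''\bigr]+h'\bigl[f''h'-f'h''\bigr]=\lambda_*,$$ $$f''+(n-1)\frac{f'h''}{h'}=0 .$$ -/

import Mathlib

open Bundle TopologicalSpace
open scoped Manifold ContDiff

set_option maxSynthPendingDepth 3

noncomputable section

namespace RBSoliton

section Local

/-! Riemannian geometry on an open piece of a finite-dimensional vector space `E`: the metric is a
function `G` assigning to each point a bilinear form on `E`. -/

variable {E : Type*} [NormedAddCommGroup E] [NormedSpace ℝ E]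

/-- The Christoffel symbols of the first kind, without an index raised:
`(u, v) ↦ (w ↦ ½ (∂_u G(v,w) + ∂_v G(u,w) - ∂_w G(u,v)))` at the point `y`. -/
def koszul (G : E → E →L[ℝ] E →L[ℝ] ℝ) (y : E) : E →L[ℝ] E →L[ℝ] (E →L[ℝ] ℝ) :=
  let D : E →L[ℝ] E →L[ℝ] (E →L[ℝ] ℝ) := fderiv ℝ G y
  let T : E →L[ℝ] E →L[ℝ] (E →L[ℝ] ℝ) :=
    (ContinuousLinearMap.flipₗᵢ ℝ E E ℝ).toContinuousLinearEquiv.toContinuousLinearMap.comp D.flip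
  (1 / 2 : ℝ) • (D + D.flip - T)

lemma koszul_apply (G : E → E →L[ℝ] E →L[ℝ] ℝ) (y u v w : E) :
    koszul G y u v w =
      (1 / 2 : ℝ) * (fderiv ℝ G y u v w + fderiv ℝ G y v u w - fderiv ℝ G y w u v) := rfl

/-- The Christoffel symbols of the Levi-Civita connection of `G`: `christoffel G y u v` is the
vector with `G y (christoffel G y u v) w = koszul G y u v w` for all `w`. -/
def christoffel (G : E → E →L[ℝ] E →L[ℝ] ℝ) (y : E) : E →L[ℝ] E →L[ℝ] E :=
  (ContinuousLinearMap.compL ℝ E (E →L[ℝ] ℝ) E (G y).inverse) ∘L koszul G y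

lemma christoffel_apply (G : E → E →L[ℝ] E →L[ℝ] ℝ) (y u v : E) :
    christoffel G y u v = (G y).inverse (koszul G y u v) := rfl

/-- The derivative `(u, v, w) ↦ (∂_u Γ)(v, w)` of the Christoffel symbols. -/
def dChristoffel (G : E → E →L[ℝ] E →L[ℝ] ℝ) (y : E) : E →L[ℝ] E →L[ℝ] E →L[ℝ] E :=
  fderiv ℝ (christoffel G) y

/-- The linear map `u ↦ R(u, v) w`, where `R` is the curvature tensor of `G`, that is
`R(u, v) w = ∇_u ∇_v w - ∇_v ∇_u w` for constant vector fields `u`, `v`, `w`. -/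
def curvature (G : E → E →L[ℝ] E →L[ℝ] ℝ) (y v w : E) : E →ₗ[ℝ] E where
  toFun u := dChristoffel G y u v w - dChristoffel G y v u w
    + christoffel G y u (christoffel G y v w) - christoffel G y v (christoffel G y u w)
  map_add' a b := by
    simp only [map_add, _root_.add_apply]
    abel
  map_smul' c a := by
    simp only [map_smul, _root_.smul_apply, RingHom.id_apply, smul_sub, smul_add]

lemma curvature_apply (G : E → E →L[ℝ] E →L[ℝ] ℝ) (y u v w : E) :
    curvature G y v w u = dChristoffel G y u v w - dChristoffel G y v u w
      + christoffel G y u (christoffel G y v w) - christoffel G y v (christoffel G y u w) := rfl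

/-- The Ricci tensor `Ric(v, w) = tr (u ↦ R(u, v) w)` of `G` at `y`. -/
def localRicci (G : E → E →L[ℝ] E →L[ℝ] ℝ) (y : E) : E →ₗ[ℝ] E →ₗ[ℝ] ℝ :=
  LinearMap.mk₂ ℝ (fun v w => LinearMap.trace ℝ E (curvature G y v w))
    (fun v v' w => by
      rw [← map_add]
      congr 1
      ext u
      simp only [curvature_apply, map_add, _root_.add_apply, LinearMap.add_apply]
      abel)
    (fun c v w => by
      rw [← map_smul]
      congr 1
      ext u
      simp only [curvature_apply, map_smul, _root_.smul_apply, LinearMap.smul_apply,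
        smul_sub, smul_add])
    (fun v w w' => by
      rw [← map_add]
      congr 1
      ext u
      simp only [curvature_apply, map_add, LinearMap.add_apply]
      abel)
    (fun c v w => by
      rw [← map_smul]
      congr 1
      ext u
      simp only [curvature_apply, map_smul, LinearMap.smul_apply, smul_sub, smul_add])

/-- The Hessian `∇²F(u, v) = ∂_u ∂_v F - dF(Γ(u, v))` of a function `F` with respect to `G`. -/
def localHessian (G : E → E →L[ℝ] E →L[ℝ] ℝ) (F : E → ℝ) (y : E) : E →ₗ[ℝ] E →ₗ[ℝ] ℝ :=
  LinearMap.mk₂ ℝ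
    (fun u v => fderiv ℝ (fderiv ℝ F) y u v - fderiv ℝ F y (christoffel G y u v))
    (fun u u' v => by
      simp only [map_add, _root_.add_apply]
      abel)
    (fun c u v => by
      simp only [map_smul, _root_.smul_apply, smul_sub])
    (fun u v v' => by
      simp only [map_add]
      abel)
    (fun c u v => by
      simp only [map_smul, smul_sub])

/-- The trace `G^{ij} B_{ij}` of a bilinear form `B` with respect to the scalar product `G`, that is
the trace of the endomorphism `A` with `G(A v, w) = B(v, w)`. -/
def metricTrace [FiniteDimensional ℝ E] (G : E →L[ℝ] E →L[ℝ] ℝ) (B : E →ₗ[ℝ] E →ₗ[ℝ] ℝ) : ℝ :=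
  LinearMap.trace ℝ E
    ((G.inverse : (E →L[ℝ] ℝ) →ₗ[ℝ] E) ∘ₗ
      (LinearMap.toContinuousLinearMap : (E →ₗ[ℝ] ℝ) ≃ₗ[ℝ] (E →L[ℝ] ℝ)).toLinearMap ∘ₗ B)

end Local

section Manifold

/-! Riemannian geometry on a smooth manifold without boundary. -/

variable {E : Type*} [NormedAddCommGroup E] [NormedSpace ℝ E]
  {H : Type*} [TopologicalSpace H] (I : ModelWithCorners ℝ E H)
  (M : Type*) [TopologicalSpace M] [ChartedSpace H M] [IsManifold I ∞ M]

/-- Smooth Riemannian metrics on `M`. -/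
abbrev RMetric := ContMDiffRiemannianMetric I ∞ E (fun x : M => TangentSpace I x)

variable {I M}

/-- The metric `g` read in the chart `φ` around `x`, that is the pullback of `g` by `φ⁻¹`. -/
def metricInChart (g : RMetric I M) (x : M) (y : E) : E →L[ℝ] E →L[ℝ] ℝ :=
  let A : E →L[ℝ] TangentSpace I ((extChartAt I x).symm y) :=
    mfderiv 𝓘(ℝ, E) I (extChartAt I x).symm y
  (A.precomp ℝ) ∘L (g.inner ((extChartAt I x).symm y)) ∘L A

lemma metricInChart_apply (g : RMetric I M) (x : M) (y u v : E) :
    metricInChart g x y u v = g.inner ((extChartAt I x).symm y)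
      (mfderiv 𝓘(ℝ, E) I (extChartAt I x).symm y u)
      (mfderiv 𝓘(ℝ, E) I (extChartAt I x).symm y v) := rfl

variable [I.Boundaryless]

/-- The Ricci tensor of `g` at `x`, computed in the chart around `x`. -/
def ricci (g : RMetric I M) (x : M) : TangentSpace I x →ₗ[ℝ] TangentSpace I x →ₗ[ℝ] ℝ :=
  (localRicci (metricInChart g x) (extChartAt I x x)).compl₁₂
    (mfderiv I 𝓘(ℝ, E) (extChartAt I x) x).toLinearMap
    (mfderiv I 𝓘(ℝ, E) (extChartAt I x) x).toLinearMap

/-- The Hessian `∇²F` of the function `F` at `x`, computed in the chart around `x`. -/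
def hessian (g : RMetric I M) (F : M → ℝ) (x : M) :
    TangentSpace I x →ₗ[ℝ] TangentSpace I x →ₗ[ℝ] ℝ :=
  (localHessian (metricInChart g x) (F ∘ (extChartAt I x).symm) (extChartAt I x x)).compl₁₂
    (mfderiv I 𝓘(ℝ, E) (extChartAt I x) x).toLinearMap
    (mfderiv I 𝓘(ℝ, E) (extChartAt I x) x).toLinearMap

variable [FiniteDimensional ℝ E]

/-- The scalar curvature, the trace of the Ricci tensor. -/
def scalarCurvature (g : RMetric I M) (x : M) : ℝ :=
  metricTrace (metricInChart g x (extChartAt I x x))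
    (localRicci (metricInChart g x) (extChartAt I x x))

/-- The Laplacian `Δ F`, the trace of the Hessian. -/
def laplacian (g : RMetric I M) (F : M → ℝ) (x : M) : ℝ :=
  metricTrace (metricInChart g x (extChartAt I x x))
    (localHessian (metricInChart g x) (F ∘ (extChartAt I x).symm) (extChartAt I x x))

/-- `g` is a gradient Ricci–Bourguignon soliton with potential `F` and constants `ρ`, `lam`:
the function `F` is smooth and `Ric + ∇²F - ρ S g = lam g`. -/
def IsRicciBourguignonSoliton (g : RMetric I M) (F : M → ℝ) (ρ lam : ℝ) : Prop :=
  ContMDiff I 𝓘(ℝ, ℝ) ∞ F ∧ ∀ (x : M) (v w : TangentSpace I x),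
    ricci g x v w + hessian g F x v w - ρ * scalarCurvature g x * g.inner x v w
      = lam * g.inner x v w

/-- `g` is a steady gradient Ricci–Bourguignon soliton with potential `F`, in the traceless
normalization `ρ = 1 / dim M`. -/
def IsSteadySoliton (g : RMetric I M) (F : M → ℝ) : Prop :=
  IsRicciBourguignonSoliton g F (1 / (Module.finrank ℝ E : ℝ)) 0

/-- The normalized scalar curvature `S / dim M`; for an Einstein metric with `Ric = lam g` it is
equal to `lam`. -/
def normalizedScalarCurvature (g : RMetric I M) (x : M) : ℝ :=
  scalarCurvature g x / Module.finrank ℝ E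

/-- `g` is an Einstein metric with Einstein constant `lam`. -/
def IsEinstein (g : RMetric I M) (lam : ℝ) : Prop :=
  ∀ (x : M) (v w : TangentSpace I x), ricci g x v w = lam * g.inner x v w

end Manifold

section Warped

variable {E : Type*} [NormedAddCommGroup E] [NormedSpace ℝ E] [FiniteDimensional ℝ E]
  {H : Type*} [TopologicalSpace H] {I : ModelWithCorners ℝ E H}
  {M : Type*} [TopologicalSpace M] [ChartedSpace H M] [IsManifold I ∞ M]

lemma isVonNBounded_of_pos (B : E →L[ℝ] E →L[ℝ] ℝ) (hB : ∀ v, v ≠ 0 → 0 < B v v) :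
    Bornology.IsVonNBounded ℝ {v : E | B v v < 1} := by
  rw [NormedSpace.isVonNBounded_iff, isBounded_iff_forall_norm_le]
  have hproper : ProperSpace E := FiniteDimensional.proper_real E
  rcases (Metric.sphere (0 : E) 1).eq_empty_or_nonempty with he | hne
  · refine ⟨0, fun v _ => ?_⟩
    by_contra hv
    have hv0 : ‖v‖ ≠ 0 := fun h => hv h.le
    have : ‖v‖⁻¹ • v ∈ Metric.sphere (0 : E) 1 := by
      simp [norm_smul, hv0]
    rw [he] at this
    exact this
  · have hc : Continuous fun v : E => B v v := by fun_prop
    obtain ⟨u, hu, hmin⟩ := (isCompact_sphere (0 : E) 1).exists_isMinOn hne hc.continuousOn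
    have hu1 : ‖u‖ = 1 := by simpa using hu
    have hu0 : u ≠ 0 := by
      rintro rfl
      simp at hu1
    have hpos := hB u hu0
    have key : ∀ v : E, B u u * ‖v‖ ^ 2 ≤ B v v := by
      intro v
      by_cases hv : v = 0
      · simp [hv]
      have hv0 : ‖v‖ ≠ 0 := by simpa using hv
      have hm : ‖v‖⁻¹ • v ∈ Metric.sphere (0 : E) 1 := by
        simp [norm_smul, hv0]
      have h1 : B u u ≤ B (‖v‖⁻¹ • v) (‖v‖⁻¹ • v) := hmin hm
      simp only [map_smul, _root_.smul_apply, smul_eq_mul] at h1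
      calc B u u * ‖v‖ ^ 2 ≤ (‖v‖⁻¹ * (‖v‖⁻¹ * B v v)) * ‖v‖ ^ 2 := by gcongr
        _ = B v v := by field_simp
    refine ⟨Real.sqrt (1 / B u u), fun v hv => Real.le_sqrt_of_sq_le ?_⟩
    rw [le_div_iff₀ hpos, mul_comm]
    exact (key v).trans (le_of_lt hv)

/-- A field of bilinear forms on the tangent bundle is smooth if its values on all pairs of vector
fields that are constant in a trivialization are smooth. -/
lemma contMDiff_bilin (s : ∀ x : M, TangentSpace I x →L[ℝ] TangentSpace I x →L[ℝ] ℝ)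
    (hs : ∀ (x₀ : M) (u v : E), ContMDiffAt I 𝓘(ℝ, ℝ) ∞
      (fun x => s x ((trivializationAt E (TangentSpace I) x₀).symmL ℝ x u)
        ((trivializationAt E (TangentSpace I) x₀).symmL ℝ x v)) x₀) :
    ContMDiff I (I.prod 𝓘(ℝ, E →L[ℝ] E →L[ℝ] ℝ)) ∞
      (fun x => TotalSpace.mk' (E →L[ℝ] E →L[ℝ] ℝ)
        (E := fun x : M => TangentSpace I x →L[ℝ] TangentSpace I x →L[ℝ] ℝ) x (s x)) := by
  intro x₀
  rw [contMDiffAt_section]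
  let b := Module.finBasis ℝ E
  let c : Fin _ → E →L[ℝ] ℝ := fun i => (b.coord i).toContinuousLinearMap
  let Φ : Fin (Module.finrank ℝ E) → Fin (Module.finrank ℝ E) → E →L[ℝ] E →L[ℝ] ℝ :=
    fun i j => (c i).smulRight (c j)
  let e := trivializationAt E (TangentSpace I) x₀
  have hsum : ContMDiffAt I 𝓘(ℝ, E →L[ℝ] E →L[ℝ] ℝ) ∞
      (fun x => ∑ i, ∑ j, (s x (e.symmL ℝ x (b i)) (e.symmL ℝ x (b j))) • Φ i j) x₀ := by
    refine contMDiffAt_finsetSum fun i _ => contMDiffAt_finsetSum fun j _ => ?_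
    exact (hs x₀ (b i) (b j)).smul contMDiffAt_const
  refine hsum.congr_of_eventuallyEq ?_
  have hx₀ : x₀ ∈ e.baseSet := FiberBundle.mem_baseSet_trivializationAt' x₀
  filter_upwards [e.open_baseSet.mem_nhds hx₀] with x hx
  rw [hom_trivializationAt_apply]
  have key : ∀ L : E →L[ℝ] E →L[ℝ] ℝ, L = ∑ i, ∑ j, (L (b i) (b j)) • Φ i j := by
    intro L
    ext u v
    conv_lhs => rw [← b.sum_repr u, ← b.sum_repr v]
    simp only [map_sum, map_smul, _root_.sum_apply, _root_.smul_apply, Φ, c,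
      ContinuousLinearMap.smulRight_apply, LinearMap.coe_toContinuousLinearMap',
      Module.Basis.coord_apply, smul_eq_mul]
    rw [Finset.sum_comm]
    refine Finset.sum_congr rfl fun i _ => ?_
    rw [Finset.mul_sum]
    refine Finset.sum_congr rfl fun j _ => ?_
    ring
  have hcoef : ∀ i j, s x (e.symmL ℝ x (b i)) (e.symmL ℝ x (b j)) =
      ContinuousLinearMap.inCoordinates E (TangentSpace I) (E →L[ℝ] ℝ)
        (fun x : M => TangentSpace I x →L[ℝ] Bundle.Trivial M ℝ x) x₀ x x₀ x (s x) (b i) (b j) := by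
    intro i j
    rw [inCoordinates_apply_eq₂ hx hx (Set.mem_univ _), e.symmL_apply hx, e.symmL_apply hx]
    simp only [Trivial.fiberBundle_trivializationAt', Trivial.linearMapAt_trivialization,
      LinearMap.id_coe, id_eq]
    rfl
  simp only [hcoef]
  exact key _

end Warped

section Product

variable {E : Type*} [NormedAddCommGroup E] [NormedSpace ℝ E]
  {H : Type*} [TopologicalSpace H] {I : ModelWithCorners ℝ E H}
  {M : Type*} [TopologicalSpace M] [ChartedSpace H M] {J : Opens ℝ}

/-- The coordinate function `t` on the product `J × M`. -/
def tCoord (J : Opens ℝ) (M : Type*) (p : J × M) : ℝ := (p.1 : ℝ)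

lemma contMDiff_tCoord : ContMDiff (𝓘(ℝ, ℝ).prod I) 𝓘(ℝ, ℝ) ∞ (tCoord J M) :=
  contMDiff_subtype_val.comp contMDiff_fst

/-- The differential `dt` at a point of `J × M`. -/
def dt (I : ModelWithCorners ℝ E H) (p : J × M) :
    TangentSpace (𝓘(ℝ, ℝ).prod I) p →L[ℝ] ℝ :=
  mfderiv (𝓘(ℝ, ℝ).prod I) 𝓘(ℝ, ℝ) (tCoord J M) p

/-- The differential of the projection `J × M → M`. -/
def dProj (I : ModelWithCorners ℝ E H) (p : J × M) :
    TangentSpace (𝓘(ℝ, ℝ).prod I) p →L[ℝ] TangentSpace I p.2 :=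
  mfderiv (𝓘(ℝ, ℝ).prod I) I Prod.snd p

lemma dt_apply (p : J × M) (v : TangentSpace (𝓘(ℝ, ℝ).prod I) p) : dt I p v = v.1 := by
  have h1 : MDifferentiableAt 𝓘(ℝ, ℝ) 𝓘(ℝ, ℝ) (Subtype.val : J → ℝ) p.1 :=
    contMDiff_subtype_val.mdifferentiableAt (n := ∞) (by simp)
  have h2 : mfderiv 𝓘(ℝ, ℝ) 𝓘(ℝ, ℝ) (Subtype.val : J → ℝ) p.1 = ContinuousLinearMap.id ℝ ℝ :=
    mfderiv_extChartAt_self (I := 𝓘(ℝ, ℝ)) (x := p.1)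
  have h3 := mfderiv_comp p h1 (mdifferentiableAt_fst (I := 𝓘(ℝ, ℝ)) (I' := I))
  have h4 : dt I p = (mfderiv 𝓘(ℝ, ℝ) 𝓘(ℝ, ℝ) (Subtype.val : J → ℝ) p.1).comp
      (mfderiv (𝓘(ℝ, ℝ).prod I) 𝓘(ℝ, ℝ) Prod.fst p) := h3
  rw [h4, h2, mfderiv_fst]
  rfl

lemma dProj_apply (p : J × M) (v : TangentSpace (𝓘(ℝ, ℝ).prod I) p) : dProj I p v = v.2 := by
  simp [dProj]
  rfl

/-- The warped product metric `dt² + h'(t)² g_*` on `J × M`. -/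
def warpedInner [IsManifold I ∞ M] (h : ℝ → ℝ) (gs : RMetric I M) (p : J × M) :
    TangentSpace (𝓘(ℝ, ℝ).prod I) p →L[ℝ] TangentSpace (𝓘(ℝ, ℝ).prod I) p →L[ℝ] ℝ :=
  (dt I p).smulRight (dt I p) +
    (deriv h p.1 ^ 2) • (((dProj I p).precomp ℝ) ∘L (gs.inner p.2) ∘L (dProj I p))

lemma warpedInner_apply [IsManifold I ∞ M] (h : ℝ → ℝ) (gs : RMetric I M) (p : J × M)
    (v w : TangentSpace (𝓘(ℝ, ℝ).prod I) p) :
    warpedInner h gs p v w =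
      dt I p v * dt I p w + deriv h p.1 ^ 2 * gs.inner p.2 (dProj I p v) (dProj I p w) := rfl

lemma warpedInner_pos [IsManifold I ∞ M] {h : ℝ → ℝ} (hne : ∀ t ∈ J, deriv h t ≠ 0)
    (gs : RMetric I M) (p : J × M) (v : TangentSpace (𝓘(ℝ, ℝ).prod I) p) (hv : v ≠ 0) :
    0 < warpedInner h gs p v v := by
  have hd : 0 < deriv h p.1 ^ 2 := by
    have := hne p.1 p.1.2
    positivity
  rw [warpedInner_apply]
  by_cases h2 : dProj I p v = 0
  · have h1 : dt I p v ≠ 0 := by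
      intro h1
      rw [dt_apply] at h1
      rw [dProj_apply] at h2
      exact hv (Prod.ext h1 h2)
    rw [h2]
    have := mul_self_pos.mpr h1
    simpa using this
  · exact add_pos_of_nonneg_of_pos (mul_self_nonneg _) (mul_pos hd (gs.pos p.2 _ h2))

lemma contMDiff_warpedInner [IsManifold I ∞ M] [FiniteDimensional ℝ E] {h : ℝ → ℝ}
    (hh : ContDiffOn ℝ ∞ h J) (gs : RMetric I M) :
    ContMDiff (𝓘(ℝ, ℝ).prod I) ((𝓘(ℝ, ℝ).prod I).prod 𝓘(ℝ, (ℝ × E) →L[ℝ] (ℝ × E) →L[ℝ] ℝ)) ∞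
      (fun p : J × M => TotalSpace.mk' ((ℝ × E) →L[ℝ] (ℝ × E) →L[ℝ] ℝ)
        (E := fun p : J × M => TangentSpace (𝓘(ℝ, ℝ).prod I) p →L[ℝ]
          TangentSpace (𝓘(ℝ, ℝ).prod I) p →L[ℝ] ℝ) p (warpedInner h gs p)) := by
  refine contMDiff_bilin _ fun p₀ u v => ?_
  simp only [warpedInner_apply]
  set e := trivializationAt (ℝ × E) (TangentSpace (𝓘(ℝ, ℝ).prod I) : J × M → Type _) p₀
  have hp₀ : p₀ ∈ e.baseSet := FiberBundle.mem_baseSet_trivializationAt' p₀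
  have hsec : ∀ u : ℝ × E, ContMDiffAt (𝓘(ℝ, ℝ).prod I) (𝓘(ℝ, ℝ).prod I).tangent ∞
      (fun p => (TotalSpace.mk' (ℝ × E) p (e.symmL ℝ p u) :
        TangentBundle (𝓘(ℝ, ℝ).prod I) (J × M))) p₀ := by
    intro u
    have h1 : ContMDiffAt ((𝓘(ℝ, ℝ).prod I).prod 𝓘(ℝ, ℝ × E)) (𝓘(ℝ, ℝ).prod I).tangent ∞
        e.toOpenPartialHomeomorph.symm (p₀, u) :=
      e.contMDiffOn_symm.contMDiffAt (e.open_target.mem_nhds (e.mem_target.mpr hp₀))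
    have h2 := h1.comp p₀ (contMDiffAt_id.prodMk (contMDiffAt_const (c := u)))
    refine h2.congr_of_eventuallyEq ?_
    filter_upwards [e.open_baseSet.mem_nhds hp₀] with p hp
    rw [e.symmL_apply hp]
    exact e.mk_symm hp u
  have hdt : ∀ u : ℝ × E, ContMDiffAt (𝓘(ℝ, ℝ).prod I) 𝓘(ℝ, ℝ) ∞
      (fun p => dt I p (e.symmL ℝ p u)) p₀ := by
    intro u
    have h1 := (contMDiff_tCoord (I := I) (J := J) (M := M)).contMDiff_tangentMap (m := ∞) (by simp)
    have h2 := (contMDiff_snd_tangentBundle_modelSpace ℝ 𝓘(ℝ, ℝ) (n := ∞)).comp h1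
    exact h2.contMDiffAt.comp p₀ (hsec u)
  have hdp : ∀ u : ℝ × E, ContMDiffAt (𝓘(ℝ, ℝ).prod I) I.tangent ∞
      (fun p => (TotalSpace.mk' E p.2 (dProj I p (e.symmL ℝ p u)) : TangentBundle I M)) p₀ := by
    intro u
    have h1 := (contMDiff_snd (I := 𝓘(ℝ, ℝ)) (J := I) (M := J) (N := M)
      (n := ∞)).contMDiff_tangentMap (m := ∞) (by simp)
    exact h1.contMDiffAt.comp p₀ (hsec u)
  have hder : ContMDiffAt (𝓘(ℝ, ℝ).prod I) 𝓘(ℝ, ℝ) ∞ (fun p : J × M => deriv h p.1) p₀ := by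
    have h1 : ContDiffOn ℝ ∞ (deriv h) J := hh.deriv_of_isOpen J.isOpen (by simp)
    have h2 : ContDiffAt ℝ ∞ (deriv h) p₀.1 := h1.contDiffAt (J.isOpen.mem_nhds p₀.1.2)
    exact h2.contMDiffAt.comp p₀ (contMDiff_tCoord (I := I)).contMDiffAt
  have hgs : ContMDiffAt (𝓘(ℝ, ℝ).prod I) 𝓘(ℝ, ℝ) ∞
      (fun p => gs.inner p.2 (dProj I p (e.symmL ℝ p u)) (dProj I p (e.symmL ℝ p v))) p₀ := by
    have h1 : ContMDiffAt (𝓘(ℝ, ℝ).prod I) (I.prod 𝓘(ℝ, ℝ)) ∞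
        (fun p : J × M => TotalSpace.mk' ℝ (E := Bundle.Trivial M ℝ) p.2
          (gs.inner p.2 (dProj I p (e.symmL ℝ p u)) (dProj I p (e.symmL ℝ p v)))) p₀ := by
      apply ContMDiffAt.clm_bundle_apply₂ (F₁ := E) (F₂ := E)
      · exact gs.contMDiff.contMDiffAt.comp p₀ contMDiffAt_snd
      · exact hdp u
      · exact hdp v
    rw [contMDiffAt_totalSpace] at h1
    exact h1.2
  exact ((hdt u).mul (hdt v)).add ((hder.pow 2).mul hgs)

/-- The warped product `dt² + h'(t)² g_*` as a Riemannian metric on `J × M`. -/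
def warpedProduct [IsManifold I ∞ M] [FiniteDimensional ℝ E] (h : ℝ → ℝ)
    (hh : ContDiffOn ℝ ∞ h J) (hne : ∀ t ∈ J, deriv h t ≠ 0) (gs : RMetric I M) :
    RMetric (𝓘(ℝ, ℝ).prod I) (J × M) where
  inner := warpedInner h gs
  symm p v w := by
    rw [warpedInner_apply, warpedInner_apply, gs.symm, mul_comm (dt I p v)]
  pos := warpedInner_pos hne gs
  isVonNBounded p :=
    isVonNBounded_of_pos (E := ℝ × E) (warpedInner h gs p) (warpedInner_pos hne gs p)
  contMDiff := contMDiff_warpedInner hh gs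

end Product

end RBSoliton

end

noncomputable section

namespace RBSoliton

open Filter Topology Module

section LocalMetric

variable {E : Type*} [NormedAddCommGroup E] [NormedSpace ℝ E]

/-- `G` is a nondegenerate symmetric metric of class `C²` near the point `y`. -/
structure IsLocalMetric (G : E → E →L[ℝ] E →L[ℝ] ℝ) (y : E) : Prop where
  contDiffAt : ContDiffAt ℝ 2 G y
  symm : ∀ᶠ z in 𝓝 y, ∀ u v, G z u v = G z v u
  invertible : (G y).IsInvertible

lemma fderiv_clm_apply₂ {F F₁ F₂ F₃ : Type*} [NormedAddCommGroup F] [NormedSpace ℝ F]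
    [NormedAddCommGroup F₁] [NormedSpace ℝ F₁] [NormedAddCommGroup F₂] [NormedSpace ℝ F₂]
    [NormedAddCommGroup F₃] [NormedSpace ℝ F₃]
    {A : F → F₁ →L[ℝ] F₂ →L[ℝ] F₃} {y : F} (hA : DifferentiableAt ℝ A y)
    (u : F) (v : F₁) (w : F₂) :
    fderiv ℝ A y u v w = fderiv ℝ (fun z => A z v w) y u := by
  have h1 : HasFDerivAt (fun z => A z v) ((fderiv ℝ A y).flip v) y := by
    simpa using hA.hasFDerivAt.clm_apply (hasFDerivAt_const v y)
  have h2 : HasFDerivAt (fun z => A z v w) (((fderiv ℝ A y).flip v).flip w) y := by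
    simpa using h1.clm_apply (hasFDerivAt_const w y)
  rw [h2.fderiv]
  rfl

variable {G : E → E →L[ℝ] E →L[ℝ] ℝ} {y : E}

namespace IsLocalMetric

lemma differentiableAt (hG : IsLocalMetric G y) : DifferentiableAt ℝ G y :=
  hG.contDiffAt.differentiableAt (by norm_num)

lemma eventually [CompleteSpace E] (hG : IsLocalMetric G y) :
    ∀ᶠ z in 𝓝 y, IsLocalMetric G z := by
  have h3 : ∀ᶠ z in 𝓝 y, (G z).IsInvertible := by
    obtain ⟨M, hM⟩ := hG.invertible
    have := ContinuousLinearEquiv.nhds M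
    rw [hM] at this
    exact hG.contDiffAt.continuousAt this
  filter_upwards [hG.contDiffAt.eventually (by simp), hG.symm.eventually_nhds, h3]
    with z h1 h2 h3
  exact ⟨h1, h2, h3⟩

lemma fderiv_symm (hG : IsLocalMetric G y) (u v w : E) :
    fderiv ℝ G y u v w = fderiv ℝ G y u w v := by
  rw [fderiv_clm_apply₂ hG.differentiableAt, fderiv_clm_apply₂ hG.differentiableAt]
  have : (fun z => G z v w) =ᶠ[𝓝 y] fun z => G z w v := by
    filter_upwards [hG.symm] with z hz using hz v w
  rw [this.fderiv_eq]

lemma apply_christoffel (hG : IsLocalMetric G y) (u v : E) :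
    G y (christoffel G y u v) = koszul G y u v :=
  hG.invertible.self_apply_inverse _

lemma christoffel_eq_iff (hG : IsLocalMetric G y) (u v x : E) :
    christoffel G y u v = x ↔ ∀ w, koszul G y u v w = G y x w := by
  rw [christoffel_apply, hG.invertible.inverse_apply_eq, ContinuousLinearMap.ext_iff]

lemma christoffel_symm (hG : IsLocalMetric G y) (u v : E) :
    christoffel G y u v = christoffel G y v u := by
  rw [hG.christoffel_eq_iff]
  intro w
  rw [hG.apply_christoffel, koszul_apply, koszul_apply, hG.fderiv_symm w u v]
  ring

lemma differentiableAt_christoffel [CompleteSpace E] (hG : IsLocalMetric G y) :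
    DifferentiableAt ℝ (christoffel G) y := by
  have h1 : DifferentiableAt ℝ (fun z => (G z).inverse) y := by
    have h2 : ContDiffAt ℝ 1 ContinuousLinearMap.inverse (G y) :=
      hG.invertible.contDiffAt_map_inverse
    exact (h2.differentiableAt (by norm_num)).comp y hG.differentiableAt
  have hD : DifferentiableAt ℝ (fderiv ℝ G) y :=
    (hG.contDiffAt.fderiv_right (m := 1) (by norm_num)).differentiableAt (by norm_num)
  have h2 : DifferentiableAt ℝ (koszul G) y := by
    have hflip : DifferentiableAt ℝ (fun z => (fderiv ℝ G z).flip) y :=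
      (ContinuousLinearMap.flipₗᵢ ℝ E E (E →L[ℝ] ℝ)).differentiable.differentiableAt.comp y hD
    exact ((hD.add hflip).sub ((differentiableAt_const _).clm_comp hflip)).const_smul (1 / 2 : ℝ)
  have h3 : DifferentiableAt ℝ (fun z => ContinuousLinearMap.compL ℝ E (E →L[ℝ] ℝ) E
      (G z).inverse) y :=
    (ContinuousLinearMap.compL ℝ E (E →L[ℝ] ℝ) E).differentiableAt.comp y h1
  exact h3.clm_comp h2

end IsLocalMetric

lemma koszul_congr {G' : E → E →L[ℝ] E →L[ℝ] ℝ} (hG : G =ᶠ[𝓝 y] G') :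
    koszul G =ᶠ[𝓝 y] koszul G' := by
  filter_upwards [hG.fderiv (𝕜 := ℝ)] with z hz
  simp only [koszul, hz]

lemma christoffel_congr {G' : E → E →L[ℝ] E →L[ℝ] ℝ} (hG : G =ᶠ[𝓝 y] G') :
    christoffel G =ᶠ[𝓝 y] christoffel G' := by
  filter_upwards [hG, koszul_congr hG] with z hz hk
  simp only [christoffel, hz, hk]

lemma localRicci_congr {G' : E → E →L[ℝ] E →L[ℝ] ℝ} (hG : G =ᶠ[𝓝 y] G') :
    localRicci G y = localRicci G' y := by
  have h1 : curvature G y = curvature G' y := by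
    funext v w
    ext u
    simp only [curvature_apply, dChristoffel, (christoffel_congr hG).fderiv_eq,
      (christoffel_congr hG).eq_of_nhds]
  ext v w
  simp only [localRicci, LinearMap.mk₂_apply, h1]

lemma localHessian_congr {G' : E → E →L[ℝ] E →L[ℝ] ℝ} {F F' : E → ℝ} (hG : G =ᶠ[𝓝 y] G')
    (hF : F =ᶠ[𝓝 y] F') : localHessian G F y = localHessian G' F' y := by
  ext v w
  simp only [localHessian, LinearMap.mk₂_apply, hF.fderiv_eq, (hF.fderiv (𝕜 := ℝ)).fderiv_eq,
    (christoffel_congr hG).eq_of_nhds]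

end LocalMetric

section MetricTrace

variable {E : Type*} [NormedAddCommGroup E] [NormedSpace ℝ E] [FiniteDimensional ℝ E]

lemma metricTrace_eq_trace {G : E →L[ℝ] E →L[ℝ] ℝ} (hG : G.IsInvertible)
    {B : E →ₗ[ℝ] E →ₗ[ℝ] ℝ} {A : E →ₗ[ℝ] E} (hA : ∀ u v, G (A u) v = B u v) :
    metricTrace G B = LinearMap.trace ℝ E A := by
  unfold metricTrace
  congr 1
  ext u
  simp only [LinearMap.comp_apply, ContinuousLinearMap.coe_coe]
  rw [hG.inverse_apply_eq]
  ext v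
  exact (hA u v).symm

/-- The endomorphism `A` with `G (A u) v = B u v`. -/
def raise (G : E →L[ℝ] E →L[ℝ] ℝ) (B : E →ₗ[ℝ] E →ₗ[ℝ] ℝ) : E →ₗ[ℝ] E :=
  (G.inverse : (E →L[ℝ] ℝ) →ₗ[ℝ] E) ∘ₗ
      (LinearMap.toContinuousLinearMap : (E →ₗ[ℝ] ℝ) ≃ₗ[ℝ] (E →L[ℝ] ℝ)).toLinearMap ∘ₗ B

lemma apply_raise {G : E →L[ℝ] E →L[ℝ] ℝ} (hG : G.IsInvertible) (B : E →ₗ[ℝ] E →ₗ[ℝ] ℝ)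
    (u v : E) : G (raise G B u) v = B u v := by
  have h := hG.self_apply_inverse (LinearMap.toContinuousLinearMap (B u))
  exact congrArg (fun L : E →L[ℝ] ℝ => L v) h

lemma metricTrace_of_eq_smul {G : E →L[ℝ] E →L[ℝ] ℝ} (hG : G.IsInvertible)
    {B : E →ₗ[ℝ] E →ₗ[ℝ] ℝ} {c : ℝ} (hB : ∀ u v, B u v = c * G u v) :
    metricTrace G B = c * finrank ℝ E := by
  rw [metricTrace_eq_trace hG (A := c • LinearMap.id) (fun u v => by simp [hB])]
  simp

lemma metricTrace_add (G : E →L[ℝ] E →L[ℝ] ℝ) (B B' : E →ₗ[ℝ] E →ₗ[ℝ] ℝ) :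
    metricTrace G (B + B') = metricTrace G B + metricTrace G B' := by
  simp only [metricTrace, LinearMap.comp_add, map_add]

lemma trace_real_prod (A : (ℝ × E) →ₗ[ℝ] ℝ × E) :
    LinearMap.trace ℝ (ℝ × E) A = (A (1, 0)).1
      + LinearMap.trace ℝ E (LinearMap.snd ℝ ℝ E ∘ₗ A ∘ₗ LinearMap.inr ℝ ℝ E) := by
  have h1 : A = (A ∘ₗ LinearMap.inl ℝ ℝ E) ∘ₗ LinearMap.fst ℝ ℝ E
      + (A ∘ₗ LinearMap.inr ℝ ℝ E) ∘ₗ LinearMap.snd ℝ ℝ E := by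
    apply LinearMap.ext
    rintro ⟨a, u⟩
    simp only [LinearMap.add_apply, LinearMap.comp_apply, LinearMap.fst_apply,
      LinearMap.snd_apply, LinearMap.inl_apply, LinearMap.inr_apply, ← map_add]
    simp
  conv_lhs => rw [h1, map_add]
  rw [LinearMap.trace_comp_comm' (LinearMap.fst ℝ ℝ E),
    LinearMap.trace_comp_comm' (LinearMap.snd ℝ ℝ E)]
  congr 1
  have h2 : LinearMap.fst ℝ ℝ E ∘ₗ A ∘ₗ LinearMap.inl ℝ ℝ E
      = (A (1, 0)).1 • (LinearMap.id : ℝ →ₗ[ℝ] ℝ) := by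
    ext
    simp
  rw [h2, map_smul, LinearMap.trace_id]
  simp

end MetricTrace

section LocalWarped

variable {E : Type*} [NormedAddCommGroup E] [NormedSpace ℝ E]

/-- The warped product `dt² + w(t)² G` on an open piece of `ℝ × E`. -/
def localWarped (w : ℝ → ℝ) (G : E → E →L[ℝ] E →L[ℝ] ℝ) (p : ℝ × E) :
    (ℝ × E) →L[ℝ] (ℝ × E) →L[ℝ] ℝ :=
  (ContinuousLinearMap.fst ℝ ℝ E).smulRight (ContinuousLinearMap.fst ℝ ℝ E) +
    (w p.1 ^ 2) • ((ContinuousLinearMap.snd ℝ ℝ E).precomp ℝ ∘L G p.2 ∘L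
      ContinuousLinearMap.snd ℝ ℝ E)

variable {w : ℝ → ℝ} {G : E → E →L[ℝ] E →L[ℝ] ℝ} {p : ℝ × E}

lemma localWarped_apply (w : ℝ → ℝ) (G : E → E →L[ℝ] E →L[ℝ] ℝ) (p U V : ℝ × E) :
    localWarped w G p U V = U.1 * V.1 + w p.1 ^ 2 * G p.2 U.2 V.2 := rfl

lemma localWarped_isInvertible (hG : (G p.2).IsInvertible) (hw : w p.1 ≠ 0) :
    (localWarped w G p).IsInvertible := by
  let A : ((ℝ × E) →L[ℝ] ℝ) →L[ℝ] ℝ × E :=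
    (ContinuousLinearMap.apply ℝ ℝ ((1, 0) : ℝ × E)).prod
      ((w p.1 ^ 2)⁻¹ • ((G p.2).inverse ∘L (ContinuousLinearMap.inr ℝ ℝ E).precomp ℝ))
  refine ContinuousLinearMap.IsInvertible.of_inverse (g := A) ?_ ?_
  · refine ContinuousLinearMap.ext fun L => ContinuousLinearMap.ext fun U => ?_
    have h1 : ∀ u : E, G p.2 ((G p.2).inverse (L.comp (ContinuousLinearMap.inr ℝ ℝ E))) u
        = L (0, u) := fun u => by rw [hG.self_apply_inverse]; rfl
    have h2 : (w p.1 ^ 2) * (w p.1 ^ 2)⁻¹ = 1 := mul_inv_cancel₀ (pow_ne_zero 2 hw)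
    have h3 : localWarped w G p (A L) U
        = L (1, 0) * U.1 + w p.1 ^ 2 * ((w p.1 ^ 2)⁻¹ * L (0, U.2)) := by
      rw [localWarped_apply, ← h1]
      change _ + w p.1 ^ 2 * G p.2 ((w p.1 ^ 2)⁻¹ • _) _ = _
      rw [map_smul]
      rfl
    change localWarped w G p (A L) U = L U
    rw [h3, ← mul_assoc, h2, one_mul]
    have h4 : U = U.1 • ((1, 0) : ℝ × E) + (0, U.2) := by ext <;> simp
    conv_rhs => rw [h4, map_add, map_smul, smul_eq_mul]
    ring
  · apply ContinuousLinearMap.ext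
    intro U
    change A (localWarped w G p U) = U
    have h2 : (w p.1 ^ 2)⁻¹ * (w p.1 ^ 2) = 1 := inv_mul_cancel₀ (pow_ne_zero 2 hw)
    apply Prod.ext
    · change localWarped w G p U (1, 0) = U.1
      simp [localWarped_apply]
    · change (w p.1 ^ 2)⁻¹ • (G p.2).inverse
        ((localWarped w G p U).comp (ContinuousLinearMap.inr ℝ ℝ E)) = U.2
      have h3 : (localWarped w G p U).comp (ContinuousLinearMap.inr ℝ ℝ E)
          = (w p.1 ^ 2) • G p.2 U.2 := by
        ext u
        simp [localWarped_apply]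
      rw [h3, map_smul, hG.inverse_apply_self, smul_smul, h2, one_smul]

lemma IsLocalMetric.localWarped (hG : IsLocalMetric G p.2) (hw : ContDiffAt ℝ 2 w p.1)
    (hw0 : w p.1 ≠ 0) : IsLocalMetric (localWarped w G) p where
  contDiffAt := by
    have h1 : ContDiffAt ℝ 2 (fun q : ℝ × E => w q.1) p := hw.comp p contDiffAt_fst
    have h2 : ContDiffAt ℝ 2 (fun q : ℝ × E => G q.2) p := hG.contDiffAt.comp p contDiffAt_snd
    exact contDiffAt_const.add ((h1.pow 2).smul
      (contDiffAt_const.clm_comp (h2.clm_comp contDiffAt_const)))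
  symm := by
    filter_upwards [continuousAt_snd.eventually hG.symm] with q hq U V
    rw [localWarped_apply, localWarped_apply, hq, mul_comm U.1]
  invertible := localWarped_isInvertible hG.invertible hw0

lemma fderiv_localWarped (hG : IsLocalMetric G p.2) (hw : ContDiffAt ℝ 2 w p.1)
    (hw0 : w p.1 ≠ 0) (U V W : ℝ × E) :
    fderiv ℝ (localWarped w G) p U V W =
      2 * w p.1 * deriv w p.1 * U.1 * G p.2 V.2 W.2 + w p.1 ^ 2 * fderiv ℝ G p.2 U.2 V.2 W.2 := by
  rw [fderiv_clm_apply₂ (hG.localWarped hw hw0).differentiableAt,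
    fderiv_clm_apply₂ hG.differentiableAt]
  simp only [localWarped_apply]
  have h1 : HasFDerivAt (fun q : ℝ × E => w q.1)
      ((deriv w p.1) • ContinuousLinearMap.fst ℝ ℝ E) p :=
    (hw.differentiableAt (by norm_num)).hasDerivAt.comp_hasFDerivAt p hasFDerivAt_fst
  have h2 : HasFDerivAt (fun q : ℝ × E => G q.2 V.2 W.2)
      ((fderiv ℝ (fun z => G z V.2 W.2) p.2).comp (ContinuousLinearMap.snd ℝ ℝ E)) p := by
    have : DifferentiableAt ℝ (fun z => G z V.2 W.2) p.2 :=
      (hG.differentiableAt.clm_apply (differentiableAt_const _)).clm_apply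
        (differentiableAt_const _)
    exact this.hasFDerivAt.comp p hasFDerivAt_snd
  have h3 := ((h1.pow 2).mul h2).const_add (V.1 * W.1)
  refine (DFunLike.congr_fun h3.fderiv U).trans ?_
  simp
  ring

lemma christoffel_localWarped (hG : IsLocalMetric G p.2) (hw : ContDiffAt ℝ 2 w p.1)
    (hw0 : w p.1 ≠ 0) (U V : ℝ × E) :
    christoffel (localWarped w G) p U V =
      (-(w p.1 * deriv w p.1) * G p.2 U.2 V.2,
        christoffel G p.2 U.2 V.2 + (deriv w p.1 / w p.1) • (U.1 • V.2 + V.1 • U.2)) := by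
  rw [(hG.localWarped hw hw0).christoffel_eq_iff]
  intro W
  simp only [koszul_apply, fderiv_localWarped hG hw hw0, localWarped_apply, map_add, map_smul,
    _root_.add_apply, _root_.smul_apply, hG.apply_christoffel, smul_eq_mul]
  field_simp
  ring

variable [CompleteSpace E]

lemma dChristoffel_localWarped (hG : IsLocalMetric G p.2) (hw : ContDiffAt ℝ 2 w p.1)
    (hw0 : w p.1 ≠ 0) (U V W : ℝ × E) :
    dChristoffel (localWarped w G) p U V W =
      (-(deriv w p.1 ^ 2 + w p.1 * deriv (deriv w) p.1) * U.1 * G p.2 V.2 W.2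
          - w p.1 * deriv w p.1 * fderiv ℝ G p.2 U.2 V.2 W.2,
        dChristoffel G p.2 U.2 V.2 W.2
          + ((deriv (deriv w) p.1 * w p.1 - deriv w p.1 ^ 2) / w p.1 ^ 2 * U.1) •
            (V.1 • W.2 + W.1 • V.2)) := by
  rw [dChristoffel, fderiv_clm_apply₂ (hG.localWarped hw hw0).differentiableAt_christoffel,
    dChristoffel, fderiv_clm_apply₂ hG.differentiableAt_christoffel,
    fderiv_clm_apply₂ hG.differentiableAt]
  have hev : (fun q => christoffel (localWarped w G) q V W) =ᶠ[𝓝 p] fun q =>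
      (-(w q.1 * deriv w q.1) * G q.2 V.2 W.2,
        christoffel G q.2 V.2 W.2 + (deriv w q.1 / w q.1) • (V.1 • W.2 + W.1 • V.2)) := by
    filter_upwards [continuousAt_snd.eventually hG.eventually,
      continuousAt_fst.eventually (hw.eventually (by simp)),
      continuousAt_fst.eventually (hw.continuousAt.eventually_ne hw0)] with q h1 h2 h3
    exact christoffel_localWarped h1 h2 h3 V W
  rw [hev.fderiv_eq]
  have hw1 : HasDerivAt w (deriv w p.1) p.1 := (hw.differentiableAt (by norm_num)).hasDerivAt
  have hw2 : HasDerivAt (deriv w) (deriv (deriv w) p.1) p.1 := by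
    have h1 : ContDiffAt ℝ 1 (fderiv ℝ w) p.1 := hw.fderiv_right (m := 1) (by norm_num)
    have h2 : DifferentiableAt ℝ (fun t => fderiv ℝ w t 1) p.1 :=
      (h1.differentiableAt (by norm_num)).clm_apply (differentiableAt_const _)
    exact h2.hasDerivAt
  have k1 : HasFDerivAt (fun q : ℝ × E => -(w q.1 * deriv w q.1)) _ p :=
    (hw1.mul hw2).neg.comp_hasFDerivAt p (hasFDerivAt_fst (𝕜 := ℝ) (E := ℝ) (F := E))
  have k2 : HasFDerivAt (fun q : ℝ × E => deriv w q.1 / w q.1) _ p :=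
    (hw2.div hw1 hw0).comp_hasFDerivAt p (hasFDerivAt_fst (𝕜 := ℝ) (E := ℝ) (F := E))
  have k3 : HasFDerivAt (fun q : ℝ × E => G q.2 V.2 W.2)
      ((fderiv ℝ (fun z => G z V.2 W.2) p.2).comp (ContinuousLinearMap.snd ℝ ℝ E)) p := by
    have : DifferentiableAt ℝ (fun z => G z V.2 W.2) p.2 :=
      (hG.differentiableAt.clm_apply (differentiableAt_const _)).clm_apply
        (differentiableAt_const _)
    exact this.hasFDerivAt.comp p hasFDerivAt_snd
  have k4 : HasFDerivAt (fun q : ℝ × E => christoffel G q.2 V.2 W.2)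
      ((fderiv ℝ (fun z => christoffel G z V.2 W.2) p.2).comp (ContinuousLinearMap.snd ℝ ℝ E))
      p := by
    have : DifferentiableAt ℝ (fun z => christoffel G z V.2 W.2) p.2 :=
      (hG.differentiableAt_christoffel.clm_apply (differentiableAt_const _)).clm_apply
        (differentiableAt_const _)
    exact this.hasFDerivAt.comp p hasFDerivAt_snd
  have k5 := (k1.mul k3).prodMk (k4.add (k2.smul_const (V.1 • W.2 + W.1 • V.2)))
  have k6 := k5.fderiv
  simp only [Pi.add_def] at k6
  refine (DFunLike.congr_fun k6 U).trans ?_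
  apply Prod.ext
  · simp
    ring
  · simp [← pow_two]

end LocalWarped

section LocalWarped

variable {E : Type*} [NormedAddCommGroup E] [NormedSpace ℝ E] [FiniteDimensional ℝ E]
  {w : ℝ → ℝ} {G : E → E →L[ℝ] E →L[ℝ] ℝ} {p : ℝ × E}

lemma localRicci_localWarped (hG : IsLocalMetric G p.2) (hw : ContDiffAt ℝ 2 w p.1)
    (hw0 : w p.1 ≠ 0) (V W : ℝ × E) :
    localRicci (localWarped w G) p V W = localRicci G p.2 V.2 W.2
      - finrank ℝ E * (deriv (deriv w) p.1 / w p.1) * (V.1 * W.1)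
      - (w p.1 * deriv (deriv w) p.1 + (finrank ℝ E - 1) * deriv w p.1 ^ 2)
        * G p.2 V.2 W.2 := by
  have : CompleteSpace E := FiniteDimensional.complete ℝ E
  have hs := hG.symm.self_of_nhds
  simp only [localRicci, LinearMap.mk₂_apply]
  rw [trace_real_prod]
  have h1 : (curvature (localWarped w G) p V W (1, 0)).1
      = -(w p.1 * deriv (deriv w) p.1) * G p.2 V.2 W.2 := by
    simp only [curvature_apply, dChristoffel_localWarped hG hw hw0,
      christoffel_localWarped hG hw hw0, map_add, map_smul, map_zero,
      _root_.zero_apply, smul_eq_mul, Prod.fst_add, Prod.fst_sub]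
    field_simp
    ring
  have h2 : LinearMap.snd ℝ ℝ E ∘ₗ curvature (localWarped w G) p V W ∘ₗ LinearMap.inr ℝ ℝ E
      = curvature G p.2 V.2 W.2
        - ((deriv (deriv w) p.1 / w p.1) * (V.1 * W.1) + deriv w p.1 ^ 2 * G p.2 V.2 W.2) •
          LinearMap.id
        + deriv w p.1 ^ 2 • (G p.2 W.2 : E →ₗ[ℝ] ℝ).smulRight V.2 := by
    apply LinearMap.ext
    intro u
    simp only [LinearMap.comp_apply, LinearMap.snd_apply, LinearMap.inr_apply, LinearMap.add_apply,
      LinearMap.sub_apply, LinearMap.smul_apply, LinearMap.id_apply, LinearMap.smulRight_apply,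
      ContinuousLinearMap.coe_coe,
      curvature_apply, dChristoffel_localWarped hG hw hw0,
      christoffel_localWarped hG hw hw0, map_add, map_smul, smul_eq_mul, Prod.snd_add,
      Prod.snd_sub,
      hG.christoffel_symm V.2 u, hs u W.2]
    match_scalars <;> field_simp <;> ring
  rw [h1, h2]
  simp only [map_add, map_sub, map_smul, LinearMap.trace_id, LinearMap.trace_smulRight,
    ContinuousLinearMap.coe_coe, smul_eq_mul, hs W.2 V.2]
  ring

omit [FiniteDimensional ℝ E] in
lemma localHessian_localWarped {f : ℝ → ℝ} (hG : IsLocalMetric G p.2) (hw : ContDiffAt ℝ 2 w p.1)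
    (hw0 : w p.1 ≠ 0) (hf : ContDiffAt ℝ 2 f p.1) (V W : ℝ × E) :
    localHessian (localWarped w G) (fun q => f q.1) p V W =
      deriv (deriv f) p.1 * (V.1 * W.1)
        + deriv f p.1 * w p.1 * deriv w p.1 * G p.2 V.2 W.2 := by
  have hev : fderiv ℝ (fun q : ℝ × E => f q.1) =ᶠ[𝓝 p]
      fun q => deriv f q.1 • ContinuousLinearMap.fst ℝ ℝ E := by
    filter_upwards [continuousAt_fst.eventually (hf.eventually (by simp))] with q hq
    exact ((hq.differentiableAt (by norm_num)).hasDerivAt.comp_hasFDerivAt q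
      hasFDerivAt_fst).fderiv
  have hf2 : HasDerivAt (deriv f) (deriv (deriv f) p.1) p.1 := by
    have h1 : ContDiffAt ℝ 1 (fderiv ℝ f) p.1 := hf.fderiv_right (m := 1) (by norm_num)
    have h2 : DifferentiableAt ℝ (fun t => fderiv ℝ f t 1) p.1 :=
      (h1.differentiableAt (by norm_num)).clm_apply (differentiableAt_const _)
    exact h2.hasDerivAt
  have h3 : HasFDerivAt (fun q : ℝ × E => deriv f q.1 • ContinuousLinearMap.fst ℝ ℝ E) _ p :=
    (hf2.comp_hasFDerivAt p (hasFDerivAt_fst (𝕜 := ℝ) (E := ℝ) (F := E))).smul_const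
      (ContinuousLinearMap.fst ℝ ℝ E)
  simp only [localHessian, LinearMap.mk₂_apply, hev.fderiv_eq, hev.eq_of_nhds, h3.fderiv,
    christoffel_localWarped hG hw hw0]
  simp
  ring

/-- The trace of `a dt² + B` with respect to a warped product metric. -/
lemma metricTrace_localWarped (hG : (G p.2).IsInvertible) (hw0 : w p.1 ≠ 0)
    {B : (ℝ × E) →ₗ[ℝ] (ℝ × E) →ₗ[ℝ] ℝ} {a : ℝ} {B' : E →ₗ[ℝ] E →ₗ[ℝ] ℝ}
    (hB : ∀ V W, B V W = a * (V.1 * W.1) + B' V.2 W.2) :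
    metricTrace (localWarped w G p) B = a + metricTrace (G p.2) B' / w p.1 ^ 2 := by
  have hw2 : w p.1 ^ 2 ≠ 0 := pow_ne_zero 2 hw0
  rw [metricTrace_eq_trace (localWarped_isInvertible hG hw0)
    (A := (a • LinearMap.id).prodMap ((w p.1 ^ 2)⁻¹ • raise (G p.2) B'))]
  · rw [LinearMap.trace_prodMap', metricTrace_eq_trace hG (apply_raise hG B')]
    simp [div_eq_inv_mul]
  · intro V W
    rw [localWarped_apply, hB]
    simp only [LinearMap.prodMap_apply, LinearMap.smul_apply, LinearMap.id_apply, map_smul,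
      _root_.smul_apply, smul_eq_mul, apply_raise hG]
    field_simp

end LocalWarped

lemma contDiffAt_clm_of_apply {D E F : Type*} [NormedAddCommGroup D] [NormedSpace ℝ D]
    [NormedAddCommGroup E] [NormedSpace ℝ E] [FiniteDimensional ℝ E] [NormedAddCommGroup F]
    [NormedSpace ℝ F] {n : WithTop ℕ∞} {f : D → E →L[ℝ] F} {y : D}
    (h : ∀ v, ContDiffAt ℝ n (fun z => f z v) y) : ContDiffAt ℝ n f y := by
  let b := Module.finBasis ℝ E
  have key : f = fun z => ∑ i, (b.coord i).toContinuousLinearMap.smulRight (f z (b i)) := by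
    funext z
    ext v
    conv_lhs => rw [← b.sum_repr v]
    simp only [map_sum, map_smul, _root_.sum_apply, ContinuousLinearMap.smulRight_apply,
      LinearMap.coe_toContinuousLinearMap', Module.Basis.coord_apply]
  rw [key]
  refine ContDiffAt.sum fun i _ => ?_
  exact contDiffAt_const.smulRight (h (b i))

section ChartMetric

variable {E : Type*} [NormedAddCommGroup E] [NormedSpace ℝ E]
  {H : Type*} [TopologicalSpace H] {I : ModelWithCorners ℝ E H} [I.Boundaryless]
  {M : Type*} [TopologicalSpace M] [ChartedSpace H M] [IsManifold I ∞ M]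

lemma metricInChart_self (g : RMetric I M) (x : M) (u v : E) :
    metricInChart g x (extChartAt I x x) u v =
      g.inner x (u : TangentSpace I x) (v : TangentSpace I x) := by
  have key : ∀ z : M, z = x → g.inner z (u : TangentSpace I z) (v : TangentSpace I z)
      = g.inner x (u : TangentSpace I x) (v : TangentSpace I x) := by
    rintro z rfl
    rfl
  have : IsManifold I 1 M := IsManifold.of_le (n := ∞) (by norm_num)
  have h1 := mfderivWithin_range_extChartAt_symm (I := I) (x := x)
  rw [I.range_eq_univ, mfderivWithin_univ] at h1
  rw [metricInChart_apply, h1]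
  exact key _ (extChartAt_to_inv x)

lemma contDiffAt_metricInChart [FiniteDimensional ℝ E] (g : RMetric I M) (x : M) :
    ContDiffAt ℝ ∞ (metricInChart g x) (extChartAt I x x) := by
  have : IsManifold I 1 M := IsManifold.of_le (n := ∞) (by norm_num)
  have hpt : ∀ u v : E, ContDiffAt ℝ ∞ (fun y => metricInChart g x y u v) (extChartAt I x x) := by
    intro u v
    set e := trivializationAt E (TangentSpace I : M → Type _) x
    have hx : x ∈ e.baseSet := FiberBundle.mem_baseSet_trivializationAt' x
    have hsec : ∀ u : E, ContMDiffAt I I.tangent ∞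
        (fun z => (TotalSpace.mk' E z (e.symmL ℝ z u) : TangentBundle I M)) x := by
      intro u
      have h1 : ContMDiffAt (I.prod 𝓘(ℝ, E)) I.tangent ∞
          e.toOpenPartialHomeomorph.symm (x, u) :=
        e.contMDiffOn_symm.contMDiffAt (e.open_target.mem_nhds (e.mem_target.mpr hx))
      have h2 := h1.comp x (contMDiffAt_id.prodMk (contMDiffAt_const (c := u)))
      refine h2.congr_of_eventuallyEq ?_
      filter_upwards [e.open_baseSet.mem_nhds hx] with p hp
      rw [e.symmL_apply hp]
      exact e.mk_symm hp u
    have h1 : ContMDiffAt I (I.prod 𝓘(ℝ, ℝ)) ∞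
        (fun z : M => TotalSpace.mk' ℝ (E := Bundle.Trivial M ℝ) z
          (g.inner z (e.symmL ℝ z u) (e.symmL ℝ z v))) x := by
      apply ContMDiffAt.clm_bundle_apply₂ (F₁ := E) (F₂ := E)
      · exact g.contMDiff.contMDiffAt
      · exact hsec u
      · exact hsec v
    rw [contMDiffAt_totalSpace] at h1
    have h2 : ContMDiffAt I 𝓘(ℝ, ℝ) ∞
        (fun z : M => g.inner z (e.symmL ℝ z u) (e.symmL ℝ z v)) x := h1.2
    have h3 : ContMDiffAt 𝓘(ℝ, E) I ∞ (extChartAt I x).symm (extChartAt I x x) :=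
      (contMDiffOn_extChartAt_symm x).contMDiffAt (extChartAt_target_mem_nhds x)
    have h4 := (h2.comp_of_eq h3 (extChartAt_to_inv x)).contDiffAt
    refine h4.congr_of_eventuallyEq ?_
    filter_upwards [extChartAt_target_mem_nhds (I := I) x] with y hy
    have hy' : (extChartAt I x).symm y ∈ (chartAt H x).source := by
      rw [← extChartAt_source I]
      exact (extChartAt I x).map_target hy
    have h5 := TangentBundle.symmL_trivializationAt (I := I) (𝕜 := ℝ) hy'
    rw [I.range_eq_univ, mfderivWithin_univ, (extChartAt I x).right_inv hy] at h5
    rw [metricInChart_apply, ← h5]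
    rfl
  exact contDiffAt_clm_of_apply fun u => contDiffAt_clm_of_apply fun v => hpt u v

lemma isLocalMetric_metricInChart [FiniteDimensional ℝ E] (g : RMetric I M) (x : M) :
    IsLocalMetric (metricInChart g x) (extChartAt I x x) where
  contDiffAt := (contDiffAt_metricInChart g x).of_le (by norm_cast)
  symm := Eventually.of_forall fun y u v => by
    rw [metricInChart_apply, metricInChart_apply, g.symm]
  invertible := by
    have hinj : Function.Injective (metricInChart g x (extChartAt I x x)) := by
      rw [injective_iff_map_eq_zero]
      intro u hu
      by_contra h
      have h1 := g.pos x (u : TangentSpace I x) h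
      rw [← metricInChart_self, hu] at h1
      exact lt_irrefl _ h1
    let L : E →ₗ[ℝ] (E →L[ℝ] ℝ) := (metricInChart g x (extChartAt I x x)).toLinearMap
    have hfin : finrank ℝ E = finrank ℝ (E →L[ℝ] ℝ) := by
      rw [← (LinearMap.toContinuousLinearMap : (E →ₗ[ℝ] ℝ) ≃ₗ[ℝ] (E →L[ℝ] ℝ)).finrank_eq]
      exact (Subspace.dual_finrank_eq).symm
    exact ⟨(L.linearEquivOfInjective hinj hfin).toContinuousLinearEquiv, by ext; rfl⟩

omit [I.Boundaryless] in
lemma ricci_apply (g : RMetric I M) (x : M) (v w : TangentSpace I x) :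
    ricci g x v w = localRicci (metricInChart g x) (extChartAt I x x) v w := by
  have : IsManifold I 1 M := IsManifold.of_le (n := ∞) (by norm_num)
  unfold ricci
  rw [mfderiv_extChartAt_self]
  rfl

omit [I.Boundaryless] in
lemma hessian_apply (g : RMetric I M) (F : M → ℝ) (x : M) (v w : TangentSpace I x) :
    hessian g F x v w = localHessian (metricInChart g x) (F ∘ (extChartAt I x).symm)
      (extChartAt I x x) v w := by
  have : IsManifold I 1 M := IsManifold.of_le (n := ∞) (by norm_num)
  unfold hessian
  rw [mfderiv_extChartAt_self]
  rfl

/-- The normalized scalar curvature of an Einstein metric is its Einstein constant. -/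
lemma IsEinstein.normalizedScalarCurvature_eq [FiniteDimensional ℝ E] {g : RMetric I M} {lam : ℝ}
    (hg : IsEinstein g lam) (hE : finrank ℝ E ≠ 0) (x : M) :
    normalizedScalarCurvature g x = lam := by
  have h1 : scalarCurvature g x = lam * finrank ℝ E := by
    refine metricTrace_of_eq_smul (isLocalMetric_metricInChart g x).invertible fun u v => ?_
    rw [metricInChart_self]
    exact (ricci_apply g x u v).symm.trans (hg x u v)
  rw [normalizedScalarCurvature, h1]
  field_simp

lemma scalarCurvature_add_laplacian [FiniteDimensional ℝ E] {g : RMetric I M} {F : M → ℝ}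
    {x : M} {c : ℝ} (hc : ∀ v w : TangentSpace I x,
      ricci g x v w + hessian g F x v w = c * g.inner x v w) :
    scalarCurvature g x + laplacian g F x = c * finrank ℝ E := by
  rw [scalarCurvature, laplacian, ← metricTrace_add]
  refine metricTrace_of_eq_smul (isLocalMetric_metricInChart g x).invertible fun u v => ?_
  rw [metricInChart_self]
  exact (congrArg₂ (· + ·) (ricci_apply g x u v) (hessian_apply g F x u v)).symm.trans (hc u v)

end ChartMetric

section WarpedProduct

variable {E : Type*} [NormedAddCommGroup E] [NormedSpace ℝ E] [FiniteDimensional ℝ E]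
  {H : Type*} [TopologicalSpace H] {I : ModelWithCorners ℝ E H} [I.Boundaryless]
  {M : Type*} [TopologicalSpace M] [ChartedSpace H M] [IsManifold I ∞ M]
  {J : Opens ℝ}

lemma extChartAt_symm_opens_eventually (t : J) :
    ∀ᶠ s in 𝓝 (t : ℝ), ((extChartAt 𝓘(ℝ, ℝ) t).symm s : ℝ) = s := by
  filter_upwards [extChartAt_target_mem_nhds (I := 𝓘(ℝ, ℝ)) t] with s hs
  exact (extChartAt 𝓘(ℝ, ℝ) t).right_inv hs

lemma metricInChart_warpedProduct {h : ℝ → ℝ} (hh : ContDiffOn ℝ ∞ h J)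
    (hne : ∀ t ∈ J, deriv h t ≠ 0) (gs : RMetric I M) (t : J) (x : M) :
    metricInChart (warpedProduct h hh hne gs) (t, x) =ᶠ[𝓝 ((t : ℝ), extChartAt I x x)]
      localWarped (deriv h) (metricInChart gs x) := by
  have hc : ∀ q : ℝ × E, (extChartAt (𝓘(ℝ, ℝ).prod I) (t, x)).symm q
      = ((extChartAt 𝓘(ℝ, ℝ) t).symm q.1, (extChartAt I x).symm q.2) := by
    intro q
    rw [extChartAt_prod]
    rfl
  have hT : ∀ᶠ q in 𝓝 ((t : ℝ), extChartAt I x x), q.1 ∈ (extChartAt 𝓘(ℝ, ℝ) t).target :=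
    continuousAt_fst.eventually (extChartAt_target_mem_nhds (I := 𝓘(ℝ, ℝ)) t)
  have hX : ∀ᶠ q in 𝓝 ((t : ℝ), extChartAt I x x), q.2 ∈ (extChartAt I x).target :=
    continuousAt_snd.eventually (extChartAt_target_mem_nhds (I := I) x)
  have hP : ∀ᶠ q in 𝓝 ((t : ℝ), extChartAt I x x),
      q ∈ (extChartAt (𝓘(ℝ, ℝ).prod I) (t, x)).target := by
    rw [extChartAt_prod]
    filter_upwards [hT, hX] with q h1 h2 using ⟨h1, h2⟩
  have hS : ∀ᶠ q in 𝓝 ((t : ℝ), extChartAt I x x),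
      ((extChartAt 𝓘(ℝ, ℝ) t).symm q.1 : ℝ) = q.1 :=
    (continuousAt_fst (p := ((t : ℝ), extChartAt I x x))).eventually
      (extChartAt_symm_opens_eventually t)
  filter_upwards [hP, hX, hS, hS.eventually_nhds] with q hqP hqX hqS hqS'
  set ψ := (extChartAt (𝓘(ℝ, ℝ).prod I) (t, x)).symm
  have : IsManifold I 1 M := IsManifold.of_le (n := ∞) (by norm_num)
  have hψd : MDifferentiableAt 𝓘(ℝ, ℝ × E) (𝓘(ℝ, ℝ).prod I) ψ q := by
    have := mdifferentiableWithinAt_extChartAt_symm (I := 𝓘(ℝ, ℝ).prod I) hqP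
    rwa [(𝓘(ℝ, ℝ).prod I).range_eq_univ, mdifferentiableWithinAt_univ] at this
  have hφd : MDifferentiableAt 𝓘(ℝ, E) I (extChartAt I x).symm q.2 := by
    have := mdifferentiableWithinAt_extChartAt_symm (I := I) hqX
    rwa [I.range_eq_univ, mdifferentiableWithinAt_univ] at this
  have hdt : ∀ U : ℝ × E, dt I (ψ q) (mfderiv 𝓘(ℝ, ℝ × E) (𝓘(ℝ, ℝ).prod I) ψ q U) = U.1 := by
    intro U
    have h1 := mfderiv_comp q
      ((contMDiff_tCoord (I := I) (J := J) (M := M)).mdifferentiableAt (by simp)) hψd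
    have h2 : (tCoord J M ∘ ψ) =ᶠ[𝓝 q] Prod.fst := by
      filter_upwards [hqS'] with r hr
      rw [Function.comp_apply, tCoord, hc]
      exact hr
    rw [h2.mfderiv_eq, mfderiv_eq_fderiv, fderiv_fst] at h1
    exact (congrArg (fun L : (ℝ × E) →L[ℝ] ℝ => L U) h1).symm
  have hdp : ∀ U : ℝ × E, dProj I (ψ q) (mfderiv 𝓘(ℝ, ℝ × E) (𝓘(ℝ, ℝ).prod I) ψ q U)
      = mfderiv 𝓘(ℝ, E) I (extChartAt I x).symm q.2 U.2 := by
    intro U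
    have h1 := mfderiv_comp q (mdifferentiableAt_snd (I := 𝓘(ℝ, ℝ)) (I' := I)) hψd
    have h2 : (Prod.snd ∘ ψ : ℝ × E → M) = (extChartAt I x).symm ∘ Prod.snd := by
      funext r
      rw [Function.comp_apply, hc]
      rfl
    have h3 : MDifferentiableAt 𝓘(ℝ, ℝ × E) 𝓘(ℝ, E) (Prod.snd : ℝ × E → E) q :=
      differentiableAt_snd.mdifferentiableAt
    have h4 := mfderiv_comp q hφd h3
    rw [h2, h4, mfderiv_eq_fderiv, fderiv_snd] at h1
    exact (congrArg (fun L : (ℝ × E) →L[ℝ] E => L U) h1).symm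
  refine ContinuousLinearMap.ext fun U => ContinuousLinearMap.ext fun V => ?_
  rw [metricInChart_apply, localWarped_apply, metricInChart_apply]
  change warpedInner h gs (ψ q) _ _ = _
  rw [warpedInner_apply, hdt, hdt, hdp, hdp]
  have h1 : ∀ p : J × M, p = ((extChartAt 𝓘(ℝ, ℝ) t).symm q.1, (extChartAt I x).symm q.2) →
      ∀ u v : E, U.1 * V.1 + deriv h p.1 ^ 2 * gs.inner p.2 (u : TangentSpace I p.2) v
        = U.1 * V.1 + deriv h q.1 ^ 2
          * gs.inner ((extChartAt I x).symm q.2) (u : TangentSpace I ((extChartAt I x).symm q.2)) v := by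
    rintro p rfl u v
    rw [hqS]
  exact h1 (ψ q) (hc q) _ _

variable {h : ℝ → ℝ} (hh : ContDiffOn ℝ ∞ h J) (hne : ∀ t ∈ J, deriv h t ≠ 0)
  (gs : RMetric I M) (t : J) (x : M)

lemma contDiffAt_deriv_of_contDiffOn {h : ℝ → ℝ} (hh : ContDiffOn ℝ ∞ h J) (t : J) :
    ContDiffAt ℝ 2 (deriv h) t :=
  ((hh.deriv_of_isOpen (m := ∞) J.isOpen (by simp)).contDiffAt
    (J.isOpen.mem_nhds t.2)).of_le (by norm_cast)

omit [FiniteDimensional ℝ E] [I.Boundaryless] [IsManifold I ∞ M] in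
lemma extChartAt_prod_self :
    extChartAt (𝓘(ℝ, ℝ).prod I) (t, x) (t, x) = ((t : ℝ), extChartAt I x x) := by
  rw [extChartAt_prod]
  rfl

/-- The Ricci tensor of a warped product. -/
lemma ricci_warpedProduct (v w : TangentSpace (𝓘(ℝ, ℝ).prod I) (t, x)) :
    ricci (warpedProduct h hh hne gs) (t, x) v w = ricci gs x v.2 w.2
      - finrank ℝ E * (deriv (deriv (deriv h)) t / deriv h t) * (v.1 * w.1)
      - (deriv h t * deriv (deriv (deriv h)) t + (finrank ℝ E - 1) * deriv (deriv h) t ^ 2)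
        * gs.inner x v.2 w.2 := by
  rw [ricci_apply, extChartAt_prod_self,
    localRicci_congr (metricInChart_warpedProduct hh hne gs t x), ← metricInChart_self]
  refine (localRicci_localWarped (p := ((t : ℝ), extChartAt I x x))
    (isLocalMetric_metricInChart gs x) (contDiffAt_deriv_of_contDiffOn hh t)
    (hne t t.2) v w).trans ?_
  exact congrArg (fun r : ℝ => r - _ - _) (ricci_apply gs x v.2 w.2).symm

lemma localHessian_warpedProduct {f : ℝ → ℝ} (hf : ContDiffOn ℝ ∞ f J) (v w : ℝ × E) :
    localHessian (metricInChart (warpedProduct h hh hne gs) (t, x))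
      ((fun p : J × M => f p.1) ∘ (extChartAt (𝓘(ℝ, ℝ).prod I) (t, x)).symm)
      ((t : ℝ), extChartAt I x x) v w =
      deriv (deriv f) t * (v.1 * w.1)
        + deriv f t * deriv h t * deriv (deriv h) t
          * metricInChart gs x (extChartAt I x x) v.2 w.2 := by
  have hF : ((fun p : J × M => f p.1) ∘ (extChartAt (𝓘(ℝ, ℝ).prod I) (t, x)).symm)
      =ᶠ[𝓝 ((t : ℝ), extChartAt I x x)] fun q => f q.1 := by
    filter_upwards [(continuousAt_fst (p := ((t : ℝ), extChartAt I x x))).eventually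
      (extChartAt_symm_opens_eventually t)] with q hq
    rw [Function.comp_apply, extChartAt_prod]
    exact congrArg f hq
  rw [localHessian_congr (metricInChart_warpedProduct hh hne gs t x) hF]
  exact localHessian_localWarped (p := ((t : ℝ), extChartAt I x x))
    (isLocalMetric_metricInChart gs x) (contDiffAt_deriv_of_contDiffOn hh t) (hne t t.2)
    ((hf.contDiffAt (J.isOpen.mem_nhds t.2)).of_le (by norm_cast)) v w

/-- The Hessian of a function of `t` on a warped product. -/
lemma hessian_warpedProduct {f : ℝ → ℝ} (hf : ContDiffOn ℝ ∞ f J)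
    (v w : TangentSpace (𝓘(ℝ, ℝ).prod I) (t, x)) :
    hessian (warpedProduct h hh hne gs) (fun p => f p.1) (t, x) v w =
      deriv (deriv f) t * (v.1 * w.1)
        + deriv f t * deriv h t * deriv (deriv h) t * gs.inner x v.2 w.2 := by
  rw [hessian_apply, extChartAt_prod_self, ← metricInChart_self]
  exact localHessian_warpedProduct hh hne gs t x hf v w

omit [I.Boundaryless] in
lemma warpedProduct_inner (v w : TangentSpace (𝓘(ℝ, ℝ).prod I) (t, x)) :
    (warpedProduct h hh hne gs).inner (t, x) v w =
      v.1 * w.1 + deriv h t ^ 2 * gs.inner x v.2 w.2 := by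
  change warpedInner h gs (t, x) v w = _
  rw [warpedInner_apply, dt_apply, dt_apply, dProj_apply, dProj_apply]

/-- The Laplacian of a function of `t` on a warped product. -/
lemma laplacian_warpedProduct {f : ℝ → ℝ} (hf : ContDiffOn ℝ ∞ f J) :
    laplacian (warpedProduct h hh hne gs) (fun p => f p.1) (t, x) =
      deriv (deriv f) t + finrank ℝ E * (deriv f t * deriv (deriv h) t / deriv h t) := by
  have hG := (isLocalMetric_metricInChart gs x).invertible
  have hB : ∀ u v : E, ((deriv f t * deriv h t * deriv (deriv h) t) •
      (metricInChart gs x (extChartAt I x x)).toLinearMap₁₂) u v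
      = (deriv f t * deriv h t * deriv (deriv h) t) * metricInChart gs x (extChartAt I x x) u v :=
    fun u v => rfl
  have h0 := hne t t.2
  rw [laplacian, extChartAt_prod_self, (metricInChart_warpedProduct hh hne gs t x).eq_of_nhds,
    metricTrace_localWarped (p := ((t : ℝ), extChartAt I x x)) (a := deriv (deriv f) t)
      (B' := (deriv f t * deriv h t * deriv (deriv h) t) •
        (metricInChart gs x (extChartAt I x x)).toLinearMap₁₂) hG h0
      (localHessian_warpedProduct hh hne gs t x hf), metricTrace_of_eq_smul hG hB]
  field_simp

/-- A warped product `dt² + h'(t)² g_*` with potential `f(t)` is a steady soliton if and only if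
`g_*` is Einstein and `h` and `f` solve two ordinary differential equations. -/
lemma isSteadySoliton_warpedProduct_iff [Nonempty M] (hJ : (J : Set ℝ).Nonempty) {f : ℝ → ℝ}
    (hf : ContDiffOn ℝ ∞ f J) (hE : finrank ℝ E ≠ 0) :
    IsSteadySoliton (warpedProduct h hh hne gs) (fun p => f p.1) ↔
      ∃ lam : ℝ, IsEinstein gs lam ∧
        (∀ t ∈ J, ((finrank ℝ E : ℝ) - 1) *
              (deriv (deriv h) t ^ 2 - deriv h t * deriv (deriv (deriv h)) t)
            + deriv h t * (deriv (deriv f) t * deriv h t - deriv f t * deriv (deriv h) t) = lam) ∧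
        (∀ t ∈ J, deriv (deriv f) t
            + finrank ℝ E * (deriv f t * deriv (deriv h) t / deriv h t) = 0) := by
  set m : ℝ := (finrank ℝ E : ℝ)
  have hn : ((finrank ℝ (ℝ × E) : ℕ) : ℝ) ≠ 0 := by
    rw [finrank_prod, finrank_self]
    positivity
  let Λ : ℝ → ℝ := fun t => (m - 1) *
      (deriv (deriv h) t ^ 2 - deriv h t * deriv (deriv (deriv h)) t)
    + deriv h t * (deriv (deriv f) t * deriv h t - deriv f t * deriv (deriv h) t)
  constructor
  · rintro ⟨-, hsol⟩
    have hlap : ∀ t ∈ J, deriv (deriv f) t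
        + m * (deriv f t * deriv (deriv h) t / deriv h t) = 0 := by
      intro t ht
      obtain ⟨x⟩ := ‹Nonempty M›
      rw [← laplacian_warpedProduct hh hne gs ⟨t, ht⟩ x hf]
      have h1 := scalarCurvature_add_laplacian (g := warpedProduct h hh hne gs)
        (F := fun p => f p.1) (x := (⟨t, ht⟩, x)) (c := 1 / (finrank ℝ (ℝ × E) : ℝ) *
          scalarCurvature (warpedProduct h hh hne gs) (⟨t, ht⟩, x)) (fun v w => by
            linarith [hsol (⟨t, ht⟩, x) v w])
      field_simp at h1
      linarith
    have hric : ∀ (t : J) (x : M) (v w : TangentSpace I x),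
        ricci gs x v w = Λ t * gs.inner x v w := by
      intro t x v w
      have h0 := hne t t.2
      let T : TangentSpace (𝓘(ℝ, ℝ).prod I) (t, x) := ((1 : ℝ), (0 : E))
      let V : TangentSpace (𝓘(ℝ, ℝ).prod I) (t, x) := ((0 : ℝ), v)
      let W : TangentSpace (𝓘(ℝ, ℝ).prod I) (t, x) := ((0 : ℝ), w)
      have h1 := hsol (t, x) T T
      have h2 := hsol (t, x) V W
      rw [ricci_warpedProduct, hessian_warpedProduct hh hne gs t x hf, warpedProduct_inner]
        at h1 h2
      set s := 1 / (finrank ℝ (ℝ × E) : ℝ) * scalarCurvature (warpedProduct h hh hne gs) (t, x)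
      have hT1 : T.1 = 1 := rfl
      have hT2 : T.2 = (0 : TangentSpace I x) := rfl
      have hV1 : V.1 = 0 := rfl
      have hV2 : V.2 = v := rfl
      have hW2 : W.2 = w := rfl
      rw [hT1, hT2, map_zero] at h1
      rw [hV1, hV2, hW2] at h2
      simp only [map_zero] at h1
      have h3 : s = deriv (deriv f) t - m * (deriv (deriv (deriv h)) t / deriv h t) := by
        linarith
      have h4 : deriv h t * (deriv (deriv (deriv h)) t / deriv h t)
          = deriv (deriv (deriv h)) t := by field_simp
      rw [h3] at h2
      simp only [Λ]
      linear_combination h2 + (-m) * deriv h t * gs.inner x v w * h4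
    obtain ⟨t₀, ht₀⟩ := hJ
    refine ⟨Λ t₀, hric ⟨t₀, ht₀⟩, fun t ht => ?_, hlap⟩
    obtain ⟨x⟩ := ‹Nonempty M›
    have : Nontrivial E := finrank_pos_iff.mp (Nat.pos_of_ne_zero hE)
    obtain ⟨v, hv⟩ := exists_ne (0 : E)
    have h1 := (hric ⟨t, ht⟩ x v v).symm.trans (hric ⟨t₀, ht₀⟩ x v v)
    exact mul_right_cancel₀ (gs.pos x v hv).ne' h1
  · rintro ⟨lam, hein, hode, hlap⟩
    refine ⟨?_, ?_⟩
    · intro p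
      exact ((hf.contDiffAt (J.isOpen.mem_nhds p.1.2)).contMDiffAt).comp p
        (contMDiff_tCoord (I := I)).contMDiffAt
    · rintro ⟨t, x⟩
      have h0 := hne t t.2
      let σ := deriv (deriv f) t - m * (deriv (deriv (deriv h)) t / deriv h t)
      have h1 : ∀ v w : TangentSpace (𝓘(ℝ, ℝ).prod I) (t, x),
          ricci (warpedProduct h hh hne gs) (t, x) v w
            + hessian (warpedProduct h hh hne gs) (fun p => f p.1) (t, x) v w
            = σ * (warpedProduct h hh hne gs).inner (t, x) v w := by
        intro v w
        rw [ricci_warpedProduct, hessian_warpedProduct hh hne gs t x hf, warpedProduct_inner]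
        have h3 := hein x v.2 w.2
        rw [← hode t t.2] at h3
        have h4 : deriv h t * (deriv (deriv (deriv h)) t / deriv h t)
            = deriv (deriv (deriv h)) t := by field_simp
        simp only [σ]
        linear_combination h3 + m * deriv h t * gs.inner x v.2 w.2 * h4
      have h2 := scalarCurvature_add_laplacian h1
      rw [laplacian_warpedProduct hh hne gs t x hf, hlap t t.2, add_zero] at h2
      intro v w
      rw [h1, h2]
      field_simp
      ring

end WarpedProduct

end RBSoliton

end

theorem mainTheorem4 (n : ℕ) (hn : 2 ≤ n)
    {M : Type*} [TopologicalSpace M] [Nonempty M]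
    [ChartedSpace (EuclideanSpace ℝ (Fin (n - 1))) M] [IsManifold (𝓡 (n - 1)) ∞ M]
    (gs : RBSoliton.RMetric (𝓡 (n - 1)) M)
    (J : Opens ℝ) (hJ : (J : Set ℝ).Nonempty) (h f : ℝ → ℝ)
    (hh : ContDiffOn ℝ ∞ h J) (hf : ContDiffOn ℝ ∞ f J)
    (hne : ∀ t ∈ J, deriv h t ≠ 0) :
    (∀ (t : J) (x : M),
      RBSoliton.laplacian (RBSoliton.warpedProduct h hh hne gs) (fun p => f p.1) (t, x) =
        iteratedDeriv 2 f t + ((n : ℝ) - 1) * (deriv f t * iteratedDeriv 2 h t / deriv h t)) ∧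
    (RBSoliton.IsSteadySoliton (RBSoliton.warpedProduct h hh hne gs) (fun p => f p.1) ↔
      ∃ lam : ℝ, RBSoliton.IsEinstein gs lam ∧
        (∀ x : M, RBSoliton.normalizedScalarCurvature gs x = lam) ∧
        (∀ t ∈ J, ((n : ℝ) - 2) *
              (iteratedDeriv 2 h t ^ 2 - deriv h t * iteratedDeriv 3 h t)
            + deriv h t * (iteratedDeriv 2 f t * deriv h t - deriv f t * iteratedDeriv 2 h t)
            = lam) ∧
        (∀ t ∈ J,
          iteratedDeriv 2 f t + ((n : ℝ) - 1) * (deriv f t * iteratedDeriv 2 h t / deriv h t)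
            = 0)) := by
  have hE : Module.finrank ℝ (EuclideanSpace ℝ (Fin (n - 1))) = n - 1 := by simp
  have hE0 : Module.finrank ℝ (EuclideanSpace ℝ (Fin (n - 1))) ≠ 0 := by omega
  have hm : ((Module.finrank ℝ (EuclideanSpace ℝ (Fin (n - 1))) : ℕ) : ℝ) = (n : ℝ) - 1 := by
    rw [hE, Nat.cast_sub (by omega), Nat.cast_one]
  have hm' : (n : ℝ) - 1 - 1 = n - 2 := by ring
  simp only [iteratedDeriv_succ, iteratedDeriv_zero]
  refine ⟨fun t x => ?_, ?_⟩
  · rw [RBSoliton.laplacian_warpedProduct hh hne gs t x hf, hm]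
  · rw [RBSoliton.isSteadySoliton_warpedProduct_iff hh hne gs hJ hf hE0, hm, hm']
    refine exists_congr fun lam => ⟨?_, ?_⟩
    · rintro ⟨h1, h2, h3⟩
      exact ⟨h1, h1.normalizedScalarCurvature_eq hE0, h2, h3⟩
    · rintro ⟨h1, -, h2, h3⟩
      exact ⟨h1, h2, h3⟩
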